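/- Let $R$ be a real $d\times d$ matrix with $R^{-1}=\lambda O$, where $0<\lambda<1$ and $O$ is orthogonal, let $b_1,\dots,b_N\in\mathbb R^d$ be distinct, let $p_1,\dots,p_N>0$ with $\sum_i p_i=1$, and put $\tau_i(x)=R^{-1}(x+b_i)$. Let $X$ be the attractor, i.e. the unique nonempty compact set with $X=\bigcup_{i=1}^N\tau_i(X)$, and let $\mu$ be the corresponding self-similar measure, i.e. the unique Borel probability measure on $\mathbb R^d$ with $\mu(E)=\sum_{i=1}^N p_i\,\mu(\tau_i^{-1}(E))$ for all Borel sets $E$. For $k\ge 1$ and a word $I=i_1\cdots i_k\in\{1,\dots,N\}^k$ put $\tau_I=\tau_{i_1}\circ\cdots\circ\tau_{i_k}$ and $p_I=p_{i_1}\cdots p_{i_k}$. Let $\mathcal A_k=\{\tau_I : I\in\{1,\dots,N\}^k\}$ (words that give the same map are identified), and for $\tau\in\mathcal A_k$ put $p_\tau=\sum\{p_I : I\in\{1,\dots,N\}^k,\ \tau_I=\tau\}$. Suppose that $\mu$ is absolutely continuous with respect to Lebesgue measure restricted to $X$, and that $\mu$ admits a frame measure, i.e. there are a Borel measure $\nu$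 on $\mathbb R^d$ and constants $A,B>0$ such that $$A\|f\|_{L^2(\mu)}^2\le\int\Big|\int f(x)e^{-2\pi i t\cdot x}\,d\mu(x)\Big|^2\,d\nu(t)\le B\|f\|_{L^2(\mu)}^2\qquad\text{for all } f\in L^2(\mu).$$ Then $p_\tau\le\lambda^{dk}$ for all $k\ge1$ and all $\tau\in\mathcal A_k$. If, moreover, $k\ge 1$ and $\tau\in\mathcal A_k$ satisfy the fixed point condition, i.e. the fixed point $x_\tau$ of $\tau$ satisfies $x_\tau\notin\widetilde\tau(X)$ for all $\widetilde\tau\in\mathcal A_k$ with $\widetilde\tau\ne\tau$, then for these $k$ and $\tau$, $p_\tau=\lambda^{dk}$. -/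

import Mathlib

open MeasureTheory

/-- An affine iterated function system on `ℝᵈ` with `N` maps and positive probability weights.
All complex eigenvalues of the real matrix `R` have modulus `> 1`, and the digits `b i` are
pairwise distinct, i.e. they enumerate a subset of `ℝᵈ` with `N` elements. -/
structure AffineIFS (d N : ℕ) where
  R : Matrix (Fin d) (Fin d) ℝ
  expansive : ∀ z ∈ spectrum ℂ (R.map (fun x : ℝ => (x : ℂ))), 1 < ‖z‖
  b : Fin N → EuclideanSpace ℝ (Fin d)
  b_injective : Function.Injective b
  p : Fin N → ℝ
  p_pos : ∀ i, 0 < p i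
  p_sum : ∑ i, p i = 1

namespace AffineIFS

variable {d N : ℕ}

/-- The maps `τ_i(x) = R⁻¹ (x + b_i)`. -/
noncomputable def map (S : AffineIFS d N) (i : Fin N) (x : EuclideanSpace ℝ (Fin d)) :
    EuclideanSpace ℝ (Fin d) :=
  Matrix.toEuclideanLin S.R⁻¹ (x + S.b i)

/-- `τ_I = τ_{i₁} ∘ ⋯ ∘ τ_{iₖ}` for a word `I = i₁ ⋯ iₖ`. -/
noncomputable def wordMap (S : AffineIFS d N) :
    List (Fin N) → EuclideanSpace ℝ (Fin d) → EuclideanSpace ℝ (Fin d)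
  | [] => id
  | i :: I => S.map i ∘ S.wordMap I

/-- `X` is the attractor: the nonempty compact set with `X = ⋃ i, τ_i(X)`. -/
def IsAttractor (S : AffineIFS d N) (X : Set (EuclideanSpace ℝ (Fin d))) : Prop :=
  IsCompact X ∧ X.Nonempty ∧ X = ⋃ i, S.map i '' X

/-- `μ` is the invariant measure: the Borel probability measure with
`μ(E) = ∑ i, p_i μ(τ_i⁻¹(E))` for all Borel sets `E`. -/
def IsInvariantMeasure (S : AffineIFS d N) (μ : Measure (EuclideanSpace ℝ (Fin d))) : Prop :=
  IsProbabilityMeasure μ ∧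
    ∀ E : Set (EuclideanSpace ℝ (Fin d)), MeasurableSet E →
      μ E = ∑ i, ENNReal.ofReal (S.p i) * μ (S.map i ⁻¹' E)

/-- The system is self-similar with contraction ratio `lam`: `R⁻¹ = lam • O`, where
`0 < lam < 1` and `O` is an orthogonal matrix. -/
def IsSelfSimilar (S : AffineIFS d N) (lam : ℝ) : Prop :=
  0 < lam ∧ lam < 1 ∧ ∃ O ∈ Matrix.orthogonalGroup (Fin d) ℝ, S.R⁻¹ = lam • O

/-- The set `𝒜_k` of classes of `k`-fold compositions. Words are identified when they give the
same map, so that a class is the same thing as the map that its words have in common. -/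
def compositions (S : AffineIFS d N) (k : ℕ) :
    Set (EuclideanSpace ℝ (Fin d) → EuclideanSpace ℝ (Fin d)) :=
  {τ | ∃ I : Fin k → Fin N, S.wordMap (List.ofFn I) = τ}

open Classical in
/-- `p_τ`: the sum of the weights `p_I = p_{i₁} ⋯ p_{iₖ}` over the words `I` of length `k` with
`τ_I = τ`. -/
noncomputable def weight (S : AffineIFS d N) (k : ℕ)
    (τ : EuclideanSpace ℝ (Fin d) → EuclideanSpace ℝ (Fin d)) : ℝ :=
  ∑ I : Fin k → Fin N, if S.wordMap (List.ofFn I) = τ then ∏ j, S.p (I j) else 0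

/-- The fixed point condition for `k` and `τ ∈ 𝒜_k`: the fixed point of `τ` lies in no `σ(X)`
with `σ ∈ 𝒜_k`, `σ ≠ τ`. -/
def FixedPointCondition (S : AffineIFS d N) (X : Set (EuclideanSpace ℝ (Fin d))) (k : ℕ)
    (τ : EuclideanSpace ℝ (Fin d) → EuclideanSpace ℝ (Fin d)) : Prop :=
  ∃ x, τ x = x ∧ ∀ σ ∈ S.compositions k, σ ≠ τ → x ∉ σ '' X

end AffineIFS

/-- The transform `t ↦ ∫ f(x) e^{-2πi t·x} dμ(x)` of the measure `f dμ` on `ℝᵈ`. -/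
noncomputable def fourierTransformOf {d : ℕ} (μ : Measure (EuclideanSpace ℝ (Fin d)))
    (f : EuclideanSpace ℝ (Fin d) → ℂ) (t : EuclideanSpace ℝ (Fin d)) : ℂ :=
  ∫ x, f x * Complex.exp (-(2 * Real.pi * inner ℝ t x : ℝ) * Complex.I) ∂μ

/-- `ν` is a frame measure for `μ`: for some `A, B > 0` and all `f ∈ L²(μ)`,
`A ‖f‖² ≤ ‖(f dμ)^‖² ≤ B ‖f‖²`, with the norms of `L²(μ)`, `L²(ν)` and `L²(μ)`. -/
def IsFrameMeasure {d : ℕ} (ν μ : Measure (EuclideanSpace ℝ (Fin d))) : Prop :=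
  ∃ A B : ℝ, 0 < A ∧ 0 < B ∧ ∀ f : EuclideanSpace ℝ (Fin d) → ℂ, MemLp f 2 μ →
    ENNReal.ofReal A * eLpNorm f 2 μ ^ 2 ≤ eLpNorm (fourierTransformOf μ f) 2 ν ^ 2 ∧
    eLpNorm (fourierTransformOf μ f) 2 ν ^ 2 ≤ ENNReal.ofReal B * eLpNorm f 2 μ ^ 2

/-! Translating a complex measure `f dμ` only multiplies its Fourier transform by a unimodular
factor, so the two frame inequalities make the `L²(μ)` norms of densities of translated measures
comparable. Testing this on indicators shows that the density of `μ` is bounded above, and bounded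
below away from its zero set (`exists_measure_bounds_of_frame`). These bounds are played against
self-similarity. Invariance gives `μ(τⁿ(X)) ≥ p_τⁿ`, whereas the Lebesgue measure of `τⁿ(X)` is
`λ^(dkn)` times that of `X`; letting `n` grow yields `p_τ ≤ λ^(dk)`. Under the fixed point condition
the other pieces miss a ball around the fixed point, so `μ(τⁿ(D)) = p_τⁿ μ(D)` for measurable `D` in
that ball, and the lower density bound gives the reverse inequality. -/

open scoped ENNReal NNReal

/-! ### Frame measures and bounds on the density -/

section Density

variable {d : ℕ}

local notation "E" => EuclideanSpace ℝ (Fin d)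

/-- The hypothesis `hfg` says that `f dμ` is `g dμ` translated by `a`, so the transforms differ by
the phase `e^{-2πi t·a}`. -/
theorem norm_fourierTransformOf_translate (h : E → ℝ≥0) (hh : Measurable h) (a : E)
    (f g : E → ℂ) (hfg : ∀ x, (h (x + a) : ℂ) * f (x + a) = (h x : ℂ) * g x) (t : E) :
    ‖fourierTransformOf (volume.withDensity fun x => (h x : ℝ≥0∞)) f t‖ =
      ‖fourierTransformOf (volume.withDensity fun x => (h x : ℝ≥0∞)) g t‖ := by
  have key : fourierTransformOf (volume.withDensity fun x => (h x : ℝ≥0∞)) f t =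
      Complex.exp ((-(2 * Real.pi * inner ℝ t a) : ℝ) * Complex.I) *
        fourierTransformOf (volume.withDensity fun x => (h x : ℝ≥0∞)) g t := by
    unfold fourierTransformOf
    rw [integral_withDensity_eq_integral_smul hh, integral_withDensity_eq_integral_smul hh,
      ← integral_add_right_eq_self _ a, ← integral_const_mul]
    congr 1
    ext x
    have e : Complex.exp (-(2 * Real.pi * inner ℝ t (x + a) : ℝ) * Complex.I) =
        Complex.exp ((-(2 * Real.pi * inner ℝ t a) : ℝ) * Complex.I) *
          Complex.exp (-(2 * Real.pi * inner ℝ t x : ℝ) * Complex.I) := by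
      rw [← Complex.exp_add, inner_add_right]
      congr 1
      push_cast
      ring
    have s (r : ℝ≥0) (z : ℂ) : r • z = (r : ℂ) * z := by
      rw [NNReal.smul_def, Complex.real_smul]
    rw [e, s, s]
    linear_combination (Complex.exp ((-(2 * Real.pi * inner ℝ t a) : ℝ) * Complex.I) *
          Complex.exp (-(2 * Real.pi * inner ℝ t x : ℝ) * Complex.I)) * hfg x
  rw [key, norm_mul, Complex.norm_exp_ofReal_mul_I, one_mul]

theorem eLpNorm_two_sq_withDensity (h : E → ℝ≥0) (hh : Measurable h) (f : E → ℂ)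
    (hf : Measurable f) :
    eLpNorm f 2 (volume.withDensity fun x => (h x : ℝ≥0∞)) ^ 2 =
      ∫⁻ x, (h x : ℝ≥0∞) * ‖f x‖ₑ ^ 2 := by
  have := eLpNorm_nnreal_pow_eq_lintegral (f := f) (p := 2)
    (μ := volume.withDensity fun x => (h x : ℝ≥0∞)) (by norm_num)
  norm_num at this
  rw [this, lintegral_withDensity_eq_lintegral_mul _ hh.coe_nnreal_ennreal (by fun_prop)]
  rfl

/-- A frame measure forces the density to be comparable with its translates. -/
theorem density_le_translate_of_frame (h : E → ℝ≥0) (hh : Measurable h)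
    [IsFiniteMeasure (volume.withDensity fun x => (h x : ℝ≥0∞))]
    (ν : Measure E) {A B : ℝ} (hA : 0 < A) (hB : 0 < B)
    (H : ∀ f : E → ℂ, MemLp f 2 (volume.withDensity fun x => (h x : ℝ≥0∞)) →
      ENNReal.ofReal A * eLpNorm f 2 (volume.withDensity fun x => (h x : ℝ≥0∞)) ^ 2 ≤
        eLpNorm (fourierTransformOf (volume.withDensity fun x => (h x : ℝ≥0∞)) f) 2 ν ^ 2 ∧
      eLpNorm (fourierTransformOf (volume.withDensity fun x => (h x : ℝ≥0∞)) f) 2 ν ^ 2 ≤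
        ENNReal.ofReal B * eLpNorm f 2 (volume.withDensity fun x => (h x : ℝ≥0∞)) ^ 2)
    (c : ℝ≥0) (hc : B < A * c) (a : E) :
    ∀ᵐ x : E, h (x + a) ≠ 0 → h x ≤ c * h (x + a) := by
  set μ := volume.withDensity fun x : E => (h x : ℝ≥0∞) with hμ
  -- The cutoffs by `n` bound the quotient `h x / h (x + a)` by `n²`, which puts the test function
  -- `f` in `L²(μ)`; every bad point satisfies them for large `n`.
  have main : ∀ n : ℕ, volume {x : E | c * h (x + a) < h x ∧ 1 ≤ n * h (x + a) ∧ h x ≤ n} = 0 := by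
    intro n
    set D : Set E := {x : E | c * h (x + a) < h x ∧ 1 ≤ n * h (x + a) ∧ h x ≤ n} with hD
    have hDm : MeasurableSet D :=
      (measurableSet_lt (by fun_prop) (by fun_prop)).inter
        ((measurableSet_le (by fun_prop) (by fun_prop)).inter
          (measurableSet_le (by fun_prop) (by fun_prop)))
    have hpos : ∀ x ∈ D, h (x + a) ≠ 0 := by
      rintro x ⟨-, h2, -⟩ h0
      simp [h0] at h2
    set g : E → ℂ := D.indicator 1 with hg
    set f : E → ℂ := fun x => D.indicator (fun y => ((h y / h (y + a) : ℝ≥0) : ℂ)) (x - a) with hf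
    have hgm : Measurable g := measurable_one.indicator hDm
    have hfm : Measurable f := by
      have : Measurable (D.indicator (fun y => ((h y / h (y + a) : ℝ≥0) : ℂ))) := by
        refine Measurable.indicator ?_ hDm
        have : Measurable fun y => (h y / h (y + a) : ℝ≥0) := by fun_prop
        exact Complex.measurable_ofReal.comp (measurable_coe_nnreal_real.comp this)
      exact this.comp (measurable_sub_const a)
    have hgL : MemLp g 2 μ := by
      refine MemLp.of_bound hgm.aestronglyMeasurable 1 (Filter.Eventually.of_forall fun x => ?_)
      by_cases hx : x ∈ D <;> simp [hg, hx]
    have hfL : MemLp f 2 μ := by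
      refine MemLp.of_bound hfm.aestronglyMeasurable (n * n) (Filter.Eventually.of_forall fun x => ?_)
      by_cases hx : x - a ∈ D
      · have h1 := hx.2.1
        have h2 := hx.2.2
        have h3 := hpos _ hx
        simp only [hf, Set.indicator_of_mem hx, Complex.norm_real, Real.norm_eq_abs, NNReal.abs_eq]
        have : h (x - a) / h (x - a + a) ≤ n * n := by
          rw [div_le_iff₀ (pos_iff_ne_zero.2 h3), mul_assoc]
          calc h (x - a) ≤ n * 1 := by simpa using h2
            _ ≤ _ := by gcongr
        exact_mod_cast this
      · simp only [hf, Set.indicator_of_notMem hx, norm_zero]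
        positivity
    have hfg : ∀ x, (h (x + a) : ℂ) * f (x + a) = (h x : ℂ) * g x := by
      intro x
      by_cases hx : x ∈ D
      · have h3 : ((h (x + a) : ℝ) : ℂ) ≠ 0 := by
          exact_mod_cast hpos _ hx
        simp only [hf, hg, add_sub_cancel_right, Set.indicator_of_mem hx, Pi.one_apply]
        push_cast
        field_simp
      · simp [hf, hg, hx]
    have hFT : eLpNorm (fourierTransformOf μ f) 2 ν = eLpNorm (fourierTransformOf μ g) 2 ν :=
      eLpNorm_congr_norm_ae (Filter.Eventually.of_forall
        (norm_fourierTransformOf_translate h hh a f g hfg))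
    have hgn : eLpNorm g 2 μ ^ 2 = μ D := by
      rw [eLpNorm_two_sq_withDensity h hh g hgm, hμ, withDensity_apply _ hDm,
        ← lintegral_indicator hDm]
      congr 1
      ext x
      by_cases hx : x ∈ D <;> simp [hg, hx]
    -- After a translation, `‖f‖² = ∫_D h(x)² / h(x + a) dx`, and `h(x) / h(x + a) > c` on `D`.
    have hfn : c * μ D ≤ eLpNorm f 2 μ ^ 2 := by
      rw [eLpNorm_two_sq_withDensity h hh f hfm, hμ, withDensity_apply _ hDm,
        ← lintegral_indicator hDm, ← lintegral_const_mul _ (by measurability),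
        ← lintegral_add_right_eq_self (fun x => (h x : ℝ≥0∞) * ‖f x‖ₑ ^ 2) a]
      refine lintegral_mono fun x => ?_
      by_cases hx : x ∈ D
      · have h3 := hpos _ hx
        simp only [hf, add_sub_cancel_right, Set.indicator_of_mem hx]
        have e : ‖((h x / h (x + a) : ℝ≥0) : ℂ)‖ₑ = ((h x / h (x + a) : ℝ≥0) : ℝ≥0∞) := by
          rw [enorm_eq_nnnorm]
          congr 1
          ext
          simp
        rw [e]
        have : c * h x ≤ h (x + a) * (h x / h (x + a)) ^ 2 := by
          have : h (x + a) * (h x / h (x + a)) ^ 2 = (h x / h (x + a)) * h x := by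
            field_simp
          rw [this]
          gcongr
          rw [le_div_iff₀ (pos_iff_ne_zero.2 h3)]
          exact hx.1.le
        exact_mod_cast this
      · simp [hx]
    have hAB : ENNReal.ofReal (A * c) * μ D ≤ ENNReal.ofReal B * μ D := by
      calc ENNReal.ofReal (A * c) * μ D = ENNReal.ofReal A * (c * μ D) := by
            rw [ENNReal.ofReal_mul hA.le, ENNReal.ofReal_coe_nnreal, mul_assoc]
        _ ≤ ENNReal.ofReal A * eLpNorm f 2 μ ^ 2 := by gcongr
        _ ≤ _ := (H f hfL).1
        _ = _ := by rw [hFT]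
        _ ≤ _ := (H g hgL).2
        _ = _ := by rw [hgn]
    have hD0 : μ D = 0 := by
      by_contra h0
      have := (ENNReal.mul_le_mul_iff_left h0 (measure_ne_top μ D)).1 hAB
      rw [ENNReal.ofReal_le_ofReal_iff hB.le] at this
      linarith
    rw [hμ, withDensity_apply_eq_zero hh.coe_nnreal_ennreal] at hD0
    refine measure_mono_null (fun x hx => Set.mem_inter ?_ hx) hD0
    have := hx.1
    simpa using (zero_le.trans_lt this).ne'
  have := ae_all_iff.2 fun n => (measure_eq_zero_iff_ae_notMem.1 (main n))
  filter_upwards [this] with x hx h0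
  by_contra! hlt
  obtain ⟨n, hn⟩ := exists_nat_ge (max (h x) (h (x + a))⁻¹)
  refine hx n ⟨hlt, ?_, (le_max_left _ _).trans hn⟩
  have := (le_max_right _ _).trans hn
  rwa [inv_le_iff_one_le_mul₀ (pos_iff_ne_zero.2 h0)] at this

/-- By Fubini, a single base point `x` with `h x ≠ 0` can be compared with almost every other point.
Hence `h ≤ c * h x` almost everywhere, and `h ≥ h x / c` almost everywhere on `{h ≠ 0}`. -/
theorem exists_measure_bounds_of_frame (μ : Measure E) [IsProbabilityMeasure μ]
    (hac : μ ≪ volume) (hframe : ∃ ν : Measure E, IsFrameMeasure ν μ) :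
    ∃ (m M : ℝ≥0) (S : Set E), 0 < m ∧ MeasurableSet S ∧ μ Sᶜ = 0 ∧
      (∀ D, MeasurableSet D → μ D ≤ M * volume D) ∧
      (∀ D, MeasurableSet D → m * volume (D ∩ S) ≤ μ D) := by
  obtain ⟨h, hh, hμ⟩ : ∃ h : E → ℝ≥0, Measurable h ∧
      volume.withDensity (fun x => (h x : ℝ≥0∞)) = μ := by
    refine ⟨fun x => (μ.rnDeriv volume x).toNNReal, by fun_prop, ?_⟩
    conv_rhs => rw [← Measure.withDensity_rnDeriv_eq μ volume hac]
    refine withDensity_congr_ae ?_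
    filter_upwards [Measure.rnDeriv_lt_top μ volume] with x hx
    exact ENNReal.coe_toNNReal hx.ne
  subst hμ
  obtain ⟨ν, A, B, hA, hB, H⟩ := hframe
  obtain ⟨c, hc⟩ : ∃ c : ℝ≥0, B < A * c := by
    refine ⟨(B / A + 1).toNNReal, ?_⟩
    rw [Real.coe_toNNReal _ (by positivity)]
    field_simp
    linarith
  have h1 : ∀ a : E, ∀ᵐ x : E, h (x + a) ≠ 0 → h x ≤ c * h (x + a) :=
    density_le_translate_of_frame h hh ν hA hB H c hc
  have h2 : ∀ a : E, ∀ᵐ x : E, h x ≠ 0 → h (x + a) ≤ c * h x := by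
    intro a
    have := (measurePreserving_add_right (volume : Measure E) a).quasiMeasurePreserving.ae (h1 (-a))
    simpa using this
  have h3 : ∀ᵐ x : E, ∀ᵐ a : E, (h (x + a) ≠ 0 → h x ≤ c * h (x + a)) ∧
      (h x ≠ 0 → h (x + a) ≤ c * h x) := by
    rw [Measure.ae_ae_comm]
    · exact Filter.Eventually.of_forall fun a => (h1 a).and (h2 a)
    · have e1 : Measurable fun z : E × E => h (z.1 + z.2) := by fun_prop
      have e2 : Measurable fun z : E × E => h z.1 := by fun_prop
      have z1 : MeasurableSet {z : E × E | h (z.1 + z.2) = 0} := e1 (measurableSet_singleton 0)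
      have z2 : MeasurableSet {z : E × E | h z.1 = 0} := e2 (measurableSet_singleton 0)
      exact (z1.compl.imp (measurableSet_le e2 (e1.const_mul c))).inter
        (z2.compl.imp (measurableSet_le e1 (e2.const_mul c)))
  obtain ⟨x, hx0, hx⟩ : ∃ x, h x ≠ 0 ∧ ∀ᵐ a : E, (h (x + a) ≠ 0 → h x ≤ c * h (x + a)) ∧
      (h x ≠ 0 → h (x + a) ≤ c * h x) := by
    by_contra hcon
    have : ∀ᵐ x : E, (h x : ℝ≥0∞) = 0 := by
      filter_upwards [h3] with x hx
      by_contra h0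
      exact hcon ⟨x, by simpa using h0, hx⟩
    have h4 : (volume.withDensity fun x : E => (h x : ℝ≥0∞)) = 0 := by
      rw [withDensity_congr_ae this]
      exact withDensity_zero
    exact IsProbabilityMeasure.ne_zero (volume.withDensity fun x : E => (h x : ℝ≥0∞)) h4
  have h5 : ∀ᵐ y : E, (h y ≠ 0 → h x ≤ c * h y) ∧ h y ≤ c * h x := by
    have := (measurePreserving_add_left (volume : Measure E) (-x)).quasiMeasurePreserving.ae hx
    filter_upwards [this] with y hy
    simp only [add_neg_cancel_left] at hy
    exact ⟨hy.1, hy.2 hx0⟩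
  have hc0 : 0 < c := by
    rw [pos_iff_ne_zero]
    rintro rfl
    simp at hc
    linarith
  have hS : MeasurableSet {y | h y ≠ 0} := (hh (measurableSet_singleton 0)).compl
  refine ⟨h x / c, c * h x, {y | h y ≠ 0}, div_pos (pos_iff_ne_zero.2 hx0) hc0, hS,
    ?_, fun D hD => ?_, fun D hD => ?_⟩
  · rw [withDensity_apply_eq_zero hh.coe_nnreal_ennreal]
    convert measure_empty (μ := (volume : Measure E))
    ext y
    simp
  · rw [withDensity_apply _ hD, ← setLIntegral_const]
    refine lintegral_mono_ae (ae_restrict_of_ae ?_)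
    filter_upwards [h5] with y hy
    exact_mod_cast hy.2
  · rw [withDensity_apply _ hD, ← setLIntegral_const]
    refine le_trans ?_ (lintegral_mono_set (Set.inter_subset_left (t := {y | h y ≠ 0})))
    refine setLIntegral_mono_ae' (hD.inter hS) ?_
    filter_upwards [h5] with y hy hyS
    have := (div_le_iff₀' hc0).2 (hy.1 hyS.2)
    exact_mod_cast this

end Density

/-! ### Scaling of distance, Lebesgue measure and the invariant measure -/

namespace AffineIFS

variable {d N : ℕ} {S : AffineIFS d N} {lam : ℝ}

local notation "E" => EuclideanSpace ℝ (Fin d)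

theorem norm_toEuclideanLin_of_mem_orthogonalGroup {O : Matrix (Fin d) (Fin d) ℝ}
    (hO : O ∈ Matrix.orthogonalGroup (Fin d) ℝ) (x : E) :
    ‖Matrix.toEuclideanLin O x‖ = ‖x‖ := by
  have h : inner ℝ (Matrix.toEuclideanLin O x) (Matrix.toEuclideanLin O x) = inner ℝ x x := by
    rw [Matrix.mem_orthogonalGroup_iff'] at hO
    rw [← LinearMap.adjoint_inner_right, ← Matrix.toEuclideanLin_conjTranspose_eq_adjoint]
    congr 1
    ext i
    simp only [Matrix.ofLp_toLpLin, Matrix.toLin'_apply, Matrix.mulVec_mulVec,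
      Matrix.conjTranspose_eq_transpose_of_trivial]
    rw [show O.transpose * O = 1 from hO, Matrix.one_mulVec]
  rw [← sq_eq_sq₀ (norm_nonneg _) (norm_nonneg _), ← real_inner_self_eq_norm_sq, h,
    real_inner_self_eq_norm_sq]

theorem dist_map (hS : S.IsSelfSimilar lam) (i : Fin N) (x y : E) :
    dist (S.map i x) (S.map i y) = lam * dist x y := by
  obtain ⟨h0, -, O, hO, hR⟩ := hS
  rw [dist_eq_norm, dist_eq_norm, map, map, ← map_sub, hR, map_smul, LinearMap.smul_apply,
    norm_smul, norm_toEuclideanLin_of_mem_orthogonalGroup hO, Real.norm_of_nonneg h0.le]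
  congr 2
  abel

theorem volume_image_map (hS : S.IsSelfSimilar lam) (i : Fin N) (D : Set E) :
    volume (S.map i '' D) = ENNReal.ofReal (lam ^ d) * volume D := by
  obtain ⟨h0, -, O, hO, hR⟩ := hS
  have hdet : |LinearMap.det (Matrix.toEuclideanLin S.R⁻¹)| = lam ^ d := by
    have : LinearMap.det (Matrix.toEuclideanLin S.R⁻¹) = S.R⁻¹.det := by
      rw [Matrix.toEuclideanLin, Matrix.toLpLin_eq_toLin, LinearMap.det_toLin]
    rw [this, hR, Matrix.det_smul, abs_mul, Fintype.card_fin, abs_of_pos (pow_pos h0 d)]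
    have h1 : O.det * O.det = 1 := by
      have := congrArg Matrix.det ((Matrix.mem_orthogonalGroup_iff' _ _).1 hO)
      rwa [Matrix.det_mul, Matrix.det_transpose, Matrix.det_one] at this
    have h2 : |O.det| * |O.det| = 1 := by rw [← abs_mul, h1, abs_one]
    have h3 : |O.det| = 1 := by nlinarith [abs_nonneg O.det]
    rw [h3, mul_one]
  have himg : S.map i '' D = Matrix.toEuclideanLin S.R⁻¹ '' ((fun x => x + S.b i) '' D) := by
    rw [Set.image_image]
    rfl
  rw [himg, Measure.addHaar_image_linearMap, hdet, Set.image_add_right, measure_preimage_add_right]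

theorem dist_wordMap (hS : S.IsSelfSimilar lam) (I : List (Fin N)) (x y : E) :
    dist (S.wordMap I x) (S.wordMap I y) = lam ^ I.length * dist x y := by
  induction I with
  | nil => simp [wordMap]
  | cons i I ih =>
    rw [wordMap, Function.comp_apply, Function.comp_apply, dist_map hS, ih, List.length_cons,
      pow_succ', mul_assoc]

theorem volume_image_wordMap (hS : S.IsSelfSimilar lam) (I : List (Fin N)) (D : Set E) :
    volume (S.wordMap I '' D) = ENNReal.ofReal (lam ^ (d * I.length)) * volume D := by
  induction I with
  | nil => simp [wordMap]
  | cons i I ih =>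
    have h0 := hS.1
    rw [wordMap, Set.image_comp, volume_image_map hS, ih, ← mul_assoc,
      ← ENNReal.ofReal_mul (by positivity), ← pow_add, List.length_cons]
    congr 3
    ring

theorem measure_eq_sum_words {μ : Measure E} (hmeas : ∀ i, Measurable (S.map i))
    (hμ : S.IsInvariantMeasure μ) (k : ℕ) (D : Set E) (hD : MeasurableSet D) :
    μ D = ∑ I : Fin k → Fin N, ENNReal.ofReal (∏ j, S.p (I j)) *
      μ (S.wordMap (List.ofFn I) ⁻¹' D) := by
  induction k generalizing D with
  | zero => simp [wordMap]
  | succ k ih =>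
    rw [hμ.2 D hD, ← (Fin.consEquiv fun _ => Fin N).sum_comp, Fintype.sum_prod_type]
    refine Finset.sum_congr rfl fun i _ => ?_
    rw [ih _ (hmeas i hD), Finset.mul_sum]
    refine Finset.sum_congr rfl fun I _ => ?_
    simp only [Fin.consEquiv, Equiv.coe_fn_mk, List.ofFn_cons, wordMap,
      Set.preimage_comp, Fin.prod_univ_succ, Fin.cons_zero, Fin.cons_succ]
    rw [ENNReal.ofReal_mul (S.p_pos i).le, mul_assoc]

theorem weight_nonneg (S : AffineIFS d N) (k : ℕ) (τ : E → E) : 0 ≤ S.weight k τ := by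
  classical
  refine Finset.sum_nonneg fun I _ => ?_
  split_ifs
  · exact Finset.prod_nonneg fun j _ => (S.p_pos _).le
  · exact le_rfl

theorem weight_pos {k : ℕ} {τ : E → E} (hτ : τ ∈ S.compositions k) : 0 < S.weight k τ := by
  classical
  obtain ⟨I, rfl⟩ := hτ
  refine Finset.sum_pos' (fun J _ => ?_) ⟨I, Finset.mem_univ _, ?_⟩
  · split_ifs
    · exact Finset.prod_nonneg fun j _ => (S.p_pos _).le
    · exact le_rfl
  · rw [if_pos rfl]
    exact Finset.prod_pos fun j _ => S.p_pos _

open Classical in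
theorem measure_eq_weight_mul_add {μ : Measure E} (hmeas : ∀ i, Measurable (S.map i))
    (hμ : S.IsInvariantMeasure μ) (k : ℕ) (τ : E → E) (D : Set E) (hD : MeasurableSet D) :
    μ D = ENNReal.ofReal (S.weight k τ) * μ (τ ⁻¹' D) +
      ∑ I : Fin k → Fin N, if S.wordMap (List.ofFn I) = τ then 0 else
        ENNReal.ofReal (∏ j, S.p (I j)) * μ (S.wordMap (List.ofFn I) ⁻¹' D) := by
  rw [measure_eq_sum_words hmeas hμ k D hD, weight, ENNReal.ofReal_sum_of_nonneg, Finset.sum_mul,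
    ← Finset.sum_add_distrib]
  · refine Finset.sum_congr rfl fun I _ => ?_
    split_ifs with h
    · rw [h, add_zero]
    · simp
  · intro I _
    split_ifs
    · exact Finset.prod_nonneg fun j _ => (S.p_pos _).le
    · exact le_rfl

theorem weight_mul_measure_le_image {μ : Measure E} (hmeas : ∀ i, Measurable (S.map i))
    (hμ : S.IsInvariantMeasure μ) (k : ℕ) {τ : E → E} (hτ : MeasurableEmbedding τ)
    (D : Set E) (hD : MeasurableSet D) :
    ENNReal.ofReal (S.weight k τ) * μ D ≤ μ (τ '' D) := by
  rw [measure_eq_weight_mul_add hmeas hμ k τ _ (hτ.measurableSet_image.2 hD),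
    Set.preimage_image_eq _ hτ.injective]
  exact le_self_add

/-- A word with a different map pulls `τ '' D` back into `Xᶜ`, which is null, so only the term of
`τ` survives. -/
theorem measure_image_eq_of_disjoint {μ : Measure E} (hmeas : ∀ i, Measurable (S.map i))
    (hμ : S.IsInvariantMeasure μ) {X : Set E} (hX : μ Xᶜ = 0) (k : ℕ) {τ : E → E}
    (hτ : MeasurableEmbedding τ) (D : Set E) (hD : MeasurableSet D)
    (hdisj : ∀ σ ∈ S.compositions k, σ ≠ τ → Disjoint (τ '' D) (σ '' X)) :
    μ (τ '' D) = ENNReal.ofReal (S.weight k τ) * μ D := by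
  classical
  rw [measure_eq_weight_mul_add hmeas hμ k τ _ (hτ.measurableSet_image.2 hD),
    Set.preimage_image_eq _ hτ.injective, Finset.sum_eq_zero, add_zero]
  intro I _
  split_ifs with h
  · rfl
  · rw [measure_mono_null _ hX, mul_zero]
    intro x hx hxX
    exact Set.disjoint_left.1 (hdisj _ ⟨I, rfl⟩ h) hx (Set.mem_image_of_mem _ hxX)

end AffineIFS

/-! ### Iteration of a single map -/

theorem le_of_forall_pow_le_const_mul_pow {x y C : ℝ} (hy : 0 < y)
    (h : ∀ n : ℕ, x ^ n ≤ C * y ^ n) : x ≤ y := by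
  by_contra! hlt
  have h1 : 1 < x / y := (one_lt_div hy).2 hlt
  obtain ⟨n, hn⟩ := pow_unbounded_of_one_lt C h1
  rw [div_pow, lt_div_iff₀ (pow_pos hy n)] at hn
  exact absurd (h n) hn.not_ge

theorem measure_iterate_image_eq {α : Type*} [MeasurableSpace α] {μ : Measure α} {τ : α → α}
    {q : ℝ≥0∞} (h : ∀ D, μ (τ '' D) = q * μ D) (n : ℕ) (D : Set α) :
    μ (τ^[n] '' D) = q ^ n * μ D := by
  induction n with
  | zero => simp
  | succ n ih => rw [Function.iterate_succ', Set.image_comp, h, ih, pow_succ', mul_assoc]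

theorem dist_iterate_eq {α : Type*} [PseudoMetricSpace α] {τ : α → α} {r : ℝ}
    (h : ∀ x y, dist (τ x) (τ y) = r * dist x y) (n : ℕ) (x y : α) :
    dist (τ^[n] x) (τ^[n] y) = r ^ n * dist x y := by
  induction n with
  | zero => simp
  | succ n ih =>
    rw [Function.iterate_succ_apply', Function.iterate_succ_apply', h, ih, pow_succ', mul_assoc]

theorem pow_mul_measure_le_iterate_image {α : Type*} [MeasurableSpace α] {μ : Measure α}
    {τ : α → α} (hτ : MeasurableEmbedding τ) {q : ℝ≥0∞}
    (h : ∀ D, MeasurableSet D → q * μ D ≤ μ (τ '' D)) (n : ℕ) {D : Set α} (hD : MeasurableSet D) :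
    MeasurableSet (τ^[n] '' D) ∧ q ^ n * μ D ≤ μ (τ^[n] '' D) := by
  induction n with
  | zero => simpa using hD
  | succ n ih =>
    rw [Function.iterate_succ', Set.image_comp]
    refine ⟨hτ.measurableSet_image.2 ih.1, le_trans ?_ (h _ ih.1)⟩
    rw [pow_succ', mul_assoc]
    gcongr
    exact ih.2

/-! ### The weight bound and the equality case -/

theorem theorem3p10 {d N : ℕ} (S : AffineIFS d N) (lam : ℝ) (hS : S.IsSelfSimilar lam)
    (X : Set (EuclideanSpace ℝ (Fin d))) (hX : S.IsAttractor X)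
    (μ : Measure (EuclideanSpace ℝ (Fin d))) (hμ : S.IsInvariantMeasure μ)
    (hac : μ ≪ (volume : Measure (EuclideanSpace ℝ (Fin d))).restrict X)
    (hframe : ∃ ν : Measure (EuclideanSpace ℝ (Fin d)), IsFrameMeasure ν μ) :
    (∀ k : ℕ, 0 < k → ∀ τ ∈ S.compositions k, S.weight k τ ≤ lam ^ (d * k)) ∧
    (∀ k : ℕ, 0 < k → ∀ τ ∈ S.compositions k, S.FixedPointCondition X k τ →
      S.weight k τ = lam ^ (d * k)) := by
  have := hμ.1
  have h0 : 0 < lam := hS.1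
  have hXm : MeasurableSet X := hX.1.measurableSet
  have hXc : μ Xᶜ = 0 := hac (by rw [Measure.restrict_apply hXm.compl]; simp)
  have hX1 : μ X = 1 := (prob_compl_eq_zero_iff hXm).1 hXc
  obtain ⟨m, M, A, hm, hA, hAc, hM, hmA⟩ :=
    exists_measure_bounds_of_frame μ (hac.trans Measure.restrict_le_self.absolutelyContinuous) hframe
  have hdist {k : ℕ} {τ : EuclideanSpace ℝ (Fin d) → EuclideanSpace ℝ (Fin d)}
      (hτ : τ ∈ S.compositions k) (x y) : dist (τ x) (τ y) = lam ^ k * dist x y := by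
    obtain ⟨I, rfl⟩ := hτ
    simpa using S.dist_wordMap hS (List.ofFn I) x y
  have hvol {k : ℕ} {τ : EuclideanSpace ℝ (Fin d) → EuclideanSpace ℝ (Fin d)}
      (hτ : τ ∈ S.compositions k) (D) :
      volume (τ '' D) = ENNReal.ofReal (lam ^ (d * k)) * volume D := by
    obtain ⟨I, rfl⟩ := hτ
    simpa using S.volume_image_wordMap hS (List.ofFn I) D
  have hcont {k : ℕ} {τ : EuclideanSpace ℝ (Fin d) → EuclideanSpace ℝ (Fin d)}
      (hτ : τ ∈ S.compositions k) : Continuous τ :=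
    (LipschitzWith.of_dist_le_mul (K := ⟨lam ^ k, by positivity⟩)
      fun x y => (hdist hτ x y).le).continuous
  have hemb {k : ℕ} {τ : EuclideanSpace ℝ (Fin d) → EuclideanSpace ℝ (Fin d)}
      (hτ : τ ∈ S.compositions k) : MeasurableEmbedding τ := by
    refine (hcont hτ).measurableEmbedding fun x y hxy => ?_
    have h1 := hdist hτ x y
    rw [hxy, dist_self] at h1
    exact dist_eq_zero.1 ((mul_eq_zero.1 h1.symm).resolve_left (by positivity))
  have hmeas (i : Fin N) : Measurable (S.map i) :=
    (hcont (k := 1) ⟨fun _ => i, by simp [AffineIFS.wordMap]⟩).measurable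
  have hle (k : ℕ) (τ) (hτ : τ ∈ S.compositions k) (n : ℕ) {D : Set _} (hD : MeasurableSet D) :=
    pow_mul_measure_le_iterate_image (hemb hτ)
      (S.weight_mul_measure_le_image hmeas hμ k (hemb hτ)) n hD
  have upper : ∀ k : ℕ, ∀ τ ∈ S.compositions k, S.weight k τ ≤ lam ^ (d * k) := by
    intro k τ hτ
    refine le_of_forall_pow_le_const_mul_pow (C := M * (volume X).toReal) (by positivity) fun n => ?_
    obtain ⟨h1, h2⟩ := hle k τ hτ n hXm
    have h3 := h2.trans (hM _ h1)
    rw [measure_iterate_image_eq (hvol hτ), hX1, mul_one] at h3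
    have hXtop : volume X ≠ ∞ := hX.1.measure_lt_top.ne
    have h4 := ENNReal.toReal_mono (by finiteness) h3
    rw [ENNReal.toReal_mul, ENNReal.toReal_mul, ENNReal.toReal_pow, ENNReal.toReal_pow,
      ENNReal.toReal_ofReal (S.weight_nonneg k τ), ENNReal.toReal_ofReal (by positivity),
      ENNReal.coe_toReal] at h4
    linarith
  refine ⟨fun k _ => upper k, fun k hk τ hτ ⟨x, hx, hfix⟩ => le_antisymm (upper k τ hτ) ?_⟩
  have hr : lam ^ k < 1 := pow_lt_one₀ h0.le hS.2.1 hk.ne'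
  have hxn (n : ℕ) : τ^[n] x = x := Function.iterate_fixed hx n
  -- a ball around the fixed point that misses the other pieces of the attractor
  obtain ⟨ρ, hρ, hball⟩ : ∃ ρ > 0, ∀ σ ∈ S.compositions k, σ ≠ τ →
      Disjoint (Metric.ball x ρ) (σ '' X) := by
    have hfin : (S.compositions k).Finite := Set.finite_range _
    have hopen : IsOpen (⋂ σ ∈ {σ ∈ S.compositions k | σ ≠ τ}, (σ '' X)ᶜ) := by
      refine (hfin.subset (Set.sep_subset _ _)).isOpen_biInter fun σ hσ => ?_
      exact (hX.1.image (hcont hσ.1)).isClosed.isOpen_compl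
    obtain ⟨ρ, hρ, h⟩ := Metric.isOpen_iff.1 hopen x (by
      simp only [Set.mem_iInter]
      exact fun σ hσ => hfix σ hσ.1 hσ.2)
    refine ⟨ρ, hρ, fun σ hσ hne => Set.disjoint_left.2 fun y hy => ?_⟩
    have := h hy
    simp only [Set.mem_iInter] at this
    exact this σ ⟨hσ, hne⟩
  have hmaps : Set.MapsTo τ (Metric.ball x ρ) (Metric.ball x ρ) := by
    intro y hy
    rw [Metric.mem_ball] at hy ⊢
    have := hdist hτ y x
    rw [hx] at this
    nlinarith [dist_nonneg (x := y) (y := x)]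
  have hexact (n : ℕ) {D : Set _} (hD : MeasurableSet D) (hDb : D ⊆ Metric.ball x ρ) :
      μ (τ^[n] '' D) = ENNReal.ofReal (S.weight k τ) ^ n * μ D := by
    induction n with
    | zero => simp
    | succ n ih =>
      have hsub : τ^[n] '' D ⊆ Metric.ball x ρ :=
        (Set.image_mono hDb).trans (hmaps.iterate n).image_subset
      rw [Function.iterate_succ', Set.image_comp,
        S.measure_image_eq_of_disjoint hmeas hμ hXc k (hemb hτ) _ (hle k τ hτ n hD).1, ih,
        pow_succ', mul_assoc]
      exact fun σ hσ hne => (hball σ hσ hne).mono_left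
        ((Set.image_mono hsub).trans hmaps.image_subset)
  -- Some iterate contracts `X` into the ball, and that image has measure at least `p_τⁿ > 0`.
  have hU : μ (Metric.ball x ρ) ≠ 0 := by
    obtain ⟨C, hC⟩ := hX.1.isBounded.subset_closedBall x
    obtain ⟨n, hn⟩ : ∃ n : ℕ, (lam ^ k) ^ n * C < ρ := by
      have h1 := (tendsto_pow_atTop_nhds_zero_of_lt_one (by positivity) hr).mul_const C
      rw [zero_mul] at h1
      exact (h1.eventually_lt_const hρ).exists
    have hsub : τ^[n] '' X ⊆ Metric.ball x ρ := by
      rintro _ ⟨y, hy, rfl⟩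
      rw [Metric.mem_ball]
      have h1 := dist_iterate_eq (hdist hτ) n y x
      rw [hxn] at h1
      rw [h1]
      refine lt_of_le_of_lt ?_ hn
      gcongr
      exact hC hy
    have h2 := (hle k τ hτ n hXm).2.trans (measure_mono hsub)
    rw [hX1, mul_one] at h2
    refine (lt_of_lt_of_le (pos_iff_ne_zero.2 (pow_ne_zero _ ?_)) h2).ne'
    simpa using S.weight_pos hτ
  -- the part of the ball on which `μ` is bounded from below by Lebesgue measure
  set V := Metric.ball x ρ ∩ A with hV
  have hVm : MeasurableSet V := measurableSet_ball.inter hA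
  have hVb : V ⊆ Metric.ball x ρ := Set.inter_subset_left
  have hVμ : μ V ≠ 0 := by
    rwa [hV, measure_inter_conull hAc]
  have hVvol : volume V ≠ 0 := fun h => hVμ (by simpa [h] using hM V hVm)
  have hVtop : volume V ≠ ∞ :=
    ((measure_mono hVb).trans_lt measure_ball_lt_top).ne
  have hlower (n : ℕ) : m * volume (τ^[n] '' V) ≤ μ (τ^[n] '' V) := by
    have hWm := (hle k τ hτ n hVm).1
    have hinj : Function.Injective τ^[n] := (hemb hτ).injective.iterate n
    have htm : Measurable τ^[n] := (hcont hτ).measurable.iterate n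
    -- The lower bound sees only `A`, so `τⁿ(V)` must be shown to lie in `A` up to a Lebesgue null
    -- set. The part outside `A` is `μ`-null; exact scaling makes its preimage `Y` in `V` `μ`-null,
    -- hence Lebesgue null since `Y ⊆ A`, and `τⁿ` preserves Lebesgue null sets.
    have hW : volume (τ^[n] '' V \ A) = 0 := by
      set Y := V ∩ τ^[n] ⁻¹' Aᶜ with hY
      have hYm : MeasurableSet Y := hVm.inter (htm hA.compl)
      have himg : τ^[n] '' V \ A = τ^[n] '' Y := by
        rw [hY, Set.image_inter_preimage]
        rfl
      have h1 : μ (τ^[n] '' Y) = 0 := by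
        rw [← himg]
        exact measure_mono_null (fun y hy => hy.2) hAc
      rw [hexact n hYm (Set.inter_subset_left.trans hVb)] at h1
      have h2 : μ Y = 0 := (mul_eq_zero.1 h1).resolve_left
        (pow_ne_zero _ (by simpa using S.weight_pos hτ))
      have h3 := hmA Y hYm
      rw [Set.inter_eq_left.2 (Set.inter_subset_left.trans Set.inter_subset_right), h2,
        nonpos_iff_eq_zero, mul_eq_zero] at h3
      rw [himg, measure_iterate_image_eq (hvol hτ), h3.resolve_left (by simpa using hm.ne'), mul_zero]
    rw [← measure_inter_add_sdiff (τ^[n] '' V) hA, hW, add_zero]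
    exact hmA _ hWm
  refine le_of_forall_pow_le_const_mul_pow
    (C := (μ V).toReal / (m * (volume V).toReal)) (S.weight_pos hτ) fun n => ?_
  have h1 := hlower n
  rw [hexact n hVm hVb, measure_iterate_image_eq (hvol hτ)] at h1
  have h2 := ENNReal.toReal_mono (by finiteness) h1
  rw [ENNReal.toReal_mul, ENNReal.toReal_mul, ENNReal.toReal_mul, ENNReal.toReal_pow,
    ENNReal.toReal_pow, ENNReal.toReal_ofReal (S.weight_nonneg k τ),
    ENNReal.toReal_ofReal (by positivity), ENNReal.coe_toReal] at h2
  have h3 : 0 < (m : ℝ) * (volume V).toReal := mul_pos (by exact_mod_cast hm)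
    (ENNReal.toReal_pos hVvol hVtop)
  rw [div_mul_eq_mul_div, le_div_iff₀ h3]
  linarith
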